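/- Let $T$ be a finite tree. A subtree of $T$ is an induced subgraph of $T$ that is itself a tree (in particular, it has at least one vertex). The mean subtree order $\mu_T$ is the average number of vertices of a subtree of $T$, taken over all subtrees of $T$. Theorem. There is an absolute constant $C$ such that, for every finite tree $T$ with $n$ vertices and diameter $d$ (the largest distance, counted in edges, between two vertices of $T$), $$\mu_T \le n - \log_2 n - 2\log_2(n-d) + C.$$ -/

import Mathlib

universe u

open scoped Classical in
/-- The subtrees of a finite tree `T`, each given by its vertex set: the sets `S` of vertices
whose induced subgraph is a tree (so `S` is non-empty). -/
noncomputable def subtrees {V : Type*} [Fintype V] (T : SimpleGraph V) : Finset (Finset V) :=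
  Finset.univ.filter fun S => (T.induce (S : Set V)).IsTree

/-- The mean subtree order `μ_T`: the average number of vertices of a subtree of `T`. -/
noncomputable def meanSubtreeOrder {V : Type*} [Fintype V] (T : SimpleGraph V) : ℝ :=
  (∑ S ∈ subtrees T, (S.card : ℝ)) / ((subtrees T).card : ℝ)

/-! Let the deficiency of a rooted tree be the average number of vertices missed by a subtree
through the root. Averaging over all subtrees instead of those through a given root can only lower
the mean order (`total_le`), so it suffices to find one root whose deficiency is at least `log n + 2
log (n - d) - 54`.

Deficiencies add when roots are identified (`deficiency_merge`). Some vertex splits the tree into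
two parts, each with at least `n / 3` vertices (`exists_balanced_merge`). The heights of the parts
sum to at most `d`, so one part has order minus height at least `(n - d) / 2`. That part contributes
`2 log (n - d)` by `log_excess_bound`, the other contributes `log n` by `logb_order_le`, up to
constants.

Both bounds rest on `log_ratio_bound`, namely `2 log n - log (h + 1) - 16 ≤ δ`. It is proved by
induction on the tree with the help of `δ ≥ (log N) / 2`, where `N` counts the subtrees through the
root. Finally, every tree graph is described by a plane tree (`Realizes`), and its subtrees obey the
same recursions because each joining edge is a bridge. -/

/-! ### Plane trees, their subtree counts and the deficiency. -/

/-- Rooted plane trees, built from the one-vertex tree by hanging the root of one tree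
below the root of another. -/
inductive PlaneTree : Type
  | single : PlaneTree
  | join : PlaneTree → PlaneTree → PlaneTree

namespace PlaneTree

/-- The number of vertices. -/
def order : PlaneTree → ℕ
  | single => 1
  | join a b => a.order + b.order

/-- The largest distance from the root to a vertex. -/
def height : PlaneTree → ℕ
  | single => 0
  | join a b => max a.height (b.height + 1)

/-- The largest distance between two vertices. -/
def diam : PlaneTree → ℕ
  | single => 0
  | join a b => max (max a.diam b.diam) (a.height + b.height + 1)

/-- The number of subtrees containing the root. -/
def rootedCount : PlaneTree → ℝ
  | single => 1
  | join a b => a.rootedCount * (1 + b.rootedCount)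

/-- The total order of the subtrees containing the root. -/
def rootedTotal : PlaneTree → ℝ
  | single => 1
  | join a b =>
    a.rootedTotal + (a.rootedTotal * b.rootedCount + a.rootedCount * b.rootedTotal)

/-- The number of subtrees. -/
def count : PlaneTree → ℝ
  | single => 1
  | join a b => a.count + b.count + a.rootedCount * b.rootedCount

/-- The total order of the subtrees. -/
def total : PlaneTree → ℝ
  | single => 1
  | join a b =>
    a.total + b.total + (a.rootedTotal * b.rootedCount + a.rootedCount * b.rootedTotal)

/-- The average number of vertices missed by a subtree containing the root. -/
noncomputable def deficiency : PlaneTree → ℝ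
  | single => 0
  | join a b => a.deficiency +
      (b.rootedCount * b.deficiency + b.order) / (1 + b.rootedCount)

/-- The deficiency of the tree obtained by hanging `b` below a new root. -/
noncomputable def stemDeficiency (b : PlaneTree) : ℝ :=
  (b.rootedCount * b.deficiency + b.order) / (1 + b.rootedCount)

theorem deficiency_join (a b : PlaneTree) :
    (join a b).deficiency = a.deficiency + b.stemDeficiency := rfl

theorem deficiency_single_join (b : PlaneTree) :
    (join single b).deficiency = b.stemDeficiency := by
  rw [deficiency_join, deficiency, zero_add]

theorem one_le_order (t : PlaneTree) : 1 ≤ t.order := by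
  induction t with
  | single => simp [order]
  | join a b ha hb => simp only [order]; omega

theorem height_lt_order (t : PlaneTree) : t.height < t.order := by
  induction t with
  | single => simp [order, height]
  | join a b ha hb => simp only [order, height]; omega

theorem order_le_rootedCount (t : PlaneTree) : (t.order : ℝ) ≤ t.rootedCount := by
  induction t with
  | single => simp [order, rootedCount]
  | join a b ha hb =>
    have h1 : (1 : ℝ) ≤ a.order := by exact_mod_cast a.one_le_order
    simp only [order, rootedCount]
    push_cast
    nlinarith [mul_nonneg (sub_nonneg.2 (h1.trans ha)) ((Nat.cast_nonneg b.order).trans hb)]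

theorem one_le_rootedCount (t : PlaneTree) : 1 ≤ t.rootedCount :=
  le_trans (by exact_mod_cast t.one_le_order) t.order_le_rootedCount

theorem rootedCount_pos (t : PlaneTree) : 0 < t.rootedCount :=
  zero_lt_one.trans_le t.one_le_rootedCount

theorem two_mul_rootedCount_le (t : PlaneTree) : 2 * t.rootedCount ≤ 2 ^ t.order := by
  induction t with
  | single => simp [order, rootedCount]
  | join a b ha hb =>
    simp only [order, rootedCount, pow_add]
    have := a.rootedCount_pos
    have := b.one_le_rootedCount
    calc 2 * (a.rootedCount * (1 + b.rootedCount))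
        = (2 * a.rootedCount) * (1 + b.rootedCount) := by ring
      _ ≤ _ := by gcongr; linarith

theorem logb_rootedCount_add_one_le (t : PlaneTree) :
    Real.logb 2 t.rootedCount + 1 ≤ t.order := by
  have h := Real.logb_le_logb_of_le one_lt_two (by linarith [t.rootedCount_pos])
    t.two_mul_rootedCount_le
  rw [Real.logb_mul two_ne_zero t.rootedCount_pos.ne', Real.logb_self_eq_one one_lt_two,
    Real.logb_pow, Real.logb_self_eq_one one_lt_two] at h
  linarith

theorem deficiency_le_sub_one (t : PlaneTree) : t.deficiency ≤ t.order - 1 := by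
  induction t with
  | single => simp [order, deficiency]
  | join a b ha hb =>
    have hN := b.rootedCount_pos
    have : (b.rootedCount * b.deficiency + b.order) / (1 + b.rootedCount) ≤ b.order := by
      rw [div_le_iff₀ (by linarith)]
      nlinarith
    simp only [order, deficiency]
    push_cast
    linarith

theorem deficiency_le (t : PlaneTree) : t.deficiency ≤ t.order := by
  linarith [t.deficiency_le_sub_one]

theorem deficiency_le_stemDeficiency (t : PlaneTree) : t.deficiency ≤ t.stemDeficiency := by
  have hN := t.rootedCount_pos
  rw [stemDeficiency, le_div_iff₀ (by linarith)]
  linarith [t.deficiency_le]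

/-- The gain from a stem: with probability `1 / (1 + N)` the whole branch is missed, which costs
`order - deficiency` more vertices than the average rooted subtree of the branch does. -/
theorem stemDeficiency_sub (t : PlaneTree) :
    t.stemDeficiency - t.deficiency = (t.order - t.deficiency) / (1 + t.rootedCount) := by
  have hN := t.rootedCount_pos
  rw [stemDeficiency]
  field_simp
  ring

/-- This ties the recursively defined `deficiency` to its meaning as an average. -/
theorem rootedTotal_eq (t : PlaneTree) :
    t.rootedTotal = t.rootedCount * (t.order - t.deficiency) := by
  induction t with
  | single => simp [rootedTotal, rootedCount, order, deficiency]
  | join a b ha hb =>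
    have hN := b.rootedCount_pos
    simp only [rootedTotal, rootedCount, order, deficiency, ha, hb]
    push_cast
    field_simp
    ring

/-! ### Deficiency against the number of rooted subtrees. -/

/-- The slope `3 / 2` exceeds `1 / log 2`. -/
theorem logb_two_le {x : ℝ} (hx : 1 ≤ x) : Real.logb 2 x ≤ 3 / 2 * (x - 1) := by
  have h2 := Real.log_two_gt_d9
  have h3 := Real.log_le_sub_one_of_pos (zero_lt_one.trans_le hx)
  rw [Real.logb, div_le_iff₀ (by linarith)]
  nlinarith

theorem logb_one_add_le {x : ℝ} (hx : 0 ≤ x) : Real.logb 2 (1 + x) ≤ 3 / 2 * x := by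
  linarith [logb_two_le (x := 1 + x) (by linarith)]

theorem half_logb_le_stemDeficiency_of {t : PlaneTree}
    (h : Real.logb 2 t.rootedCount / 2 ≤ t.deficiency) :
    Real.logb 2 (1 + t.rootedCount) / 2 ≤ t.stemDeficiency := by
  have hN := t.rootedCount_pos
  have hn := t.logb_rootedCount_add_one_le
  rw [stemDeficiency, le_div_iff₀ (by linarith)]
  rcases t with _ | ⟨a, b⟩
  -- Equality holds for the single vertex. For larger trees `N ≥ 2`, so `log N ≥ 1`, which leaves
  -- the slack used below.
  · norm_num [rootedCount, deficiency, order]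
  · set N := (join a b).rootedCount with hNdef
    have h2 : 2 ≤ N := by
      have := a.one_le_rootedCount
      have := b.one_le_rootedCount
      simp only [hNdef, rootedCount]
      nlinarith
    have e : Real.logb 2 (1 + N) = Real.logb 2 N + Real.logb 2 (1 + 1 / N) := by
      rw [← Real.logb_mul hN.ne' (by positivity)]
      congr 1
      field_simp
      ring
    have h3 : Real.logb 2 (1 + 1 / N) ≤ 3 / 2 * (1 / N) := logb_one_add_le (by positivity)
    have h4 : 1 ≤ Real.logb 2 N := by
      rw [Real.le_logb_iff_rpow_le one_lt_two hN]
      simpa using h2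
    have h5 : (1 + N) * Real.logb 2 (1 + 1 / N) ≤ 9 / 4 := by
      calc _ ≤ (1 + N) * (3 / 2 * (1 / N)) := by gcongr
        _ = 3 / 2 * (1 / N) + 3 / 2 := by field_simp
        _ ≤ _ := by
          have : 1 / N ≤ 1 / 2 := by gcongr
          linarith
    rw [e]
    nlinarith

/-- Rooted counts multiply where deficiencies add, so only the passage through a stem needs an
estimate. -/
theorem half_logb_rootedCount_le (t : PlaneTree) :
    Real.logb 2 t.rootedCount / 2 ≤ t.deficiency := by
  induction t with
  | single => simp [rootedCount, deficiency]
  | join a b ha hb =>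
    have hN := b.rootedCount_pos
    rw [deficiency_join, rootedCount, Real.logb_mul a.rootedCount_pos.ne' (by linarith)]
    linarith [half_logb_le_stemDeficiency_of hb]

theorem half_logb_le_stemDeficiency (t : PlaneTree) :
    Real.logb 2 (1 + t.rootedCount) / 2 ≤ t.stemDeficiency :=
  half_logb_le_stemDeficiency_of t.half_logb_rootedCount_le

theorem half_logb_order_le (t : PlaneTree) : Real.logb 2 t.order / 2 ≤ t.deficiency := by
  have h1 : (1 : ℝ) ≤ t.order := by exact_mod_cast t.one_le_order
  have := Real.logb_le_logb_of_le one_lt_two (by linarith) t.order_le_rootedCount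
  linarith [t.half_logb_rootedCount_le]

theorem half_logb_order_succ_le (t : PlaneTree) :
    Real.logb 2 (t.order + 1) / 2 ≤ t.stemDeficiency := by
  have h1 : (1 : ℝ) ≤ t.order := by exact_mod_cast t.one_le_order
  have := Real.logb_le_logb_of_le one_lt_two (x := (t.order : ℝ) + 1) (y := 1 + t.rootedCount)
    (by linarith) (by linarith [t.order_le_rootedCount])
  linarith [t.half_logb_le_stemDeficiency]

/-! ### Deficiency against order and height. -/

/-- Adding a part of order `y + 1` to a part of order `x` costs at most its deficiency. -/
theorem two_logb_add_le {x y δ : ℝ} (hx : 1 ≤ x) (hy : 1 ≤ y) (hyx : y ≤ x)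
    (hδ : Real.logb 2 (y + 1) / 2 ≤ δ) :
    2 * Real.logb 2 (x + y) ≤ 16 ∨ 2 * Real.logb 2 (x + y) ≤ 2 * Real.logb 2 x + δ := by
  have key : ∀ c : ℝ, 0 < c → y ≤ (c - 1) * x →
      Real.logb 2 (x + y) ≤ Real.logb 2 x + Real.logb 2 c := by
    intro c hc h
    rw [← Real.logb_mul (by linarith) hc.ne']
    exact Real.logb_le_logb_of_le one_lt_two (by linarith) (by linarith)
  have l2 : Real.logb 2 (2 : ℝ) = 1 := Real.logb_self_eq_one one_lt_two
  -- For `y ≥ 15` the sum at most doubles, costing 2, while `δ ≥ 2`. For `y < 15` and `x ≥ 96` it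
  -- grows by a factor at most `7 / 6`, costing at most `1 / 2 ≤ δ`. Otherwise `x + y < 2 ^ 8`, the
  -- source of the constant 16.
  rcases le_or_gt 15 y with h | h
  · right
    have h1 : (4 : ℝ) ≤ Real.logb 2 (y + 1) := by
      rw [Real.le_logb_iff_rpow_le one_lt_two (by linarith)]
      norm_num
      linarith
    have := key 2 two_pos (by linarith)
    linarith
  rcases le_or_gt 96 x with h' | h'
  · right
    have h1 : (1 : ℝ) ≤ Real.logb 2 (y + 1) := by
      rw [Real.le_logb_iff_rpow_le one_lt_two (by linarith)]
      norm_num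
      linarith
    have h2 := key (7 / 6) (by norm_num) (by linarith)
    have h3 : 4 * Real.logb 2 (7 / 6 : ℝ) ≤ 1 := by
      have e : 4 * Real.logb 2 (7 / 6 : ℝ) = Real.logb 2 ((7 / 6 : ℝ) ^ 4) := by
        rw [Real.logb_pow]; norm_num
      rw [e, ← l2]
      exact Real.logb_le_logb_of_le one_lt_two (by norm_num) (by norm_num)
    linarith
  · left
    have h1 : Real.logb 2 (x + y) ≤ 8 := by
      rw [Real.logb_le_iff_le_rpow one_lt_two (by linarith)]
      norm_num
      linarith
    linarith

/-- Keep the bound of the larger part; the smaller one pays for its own vertices through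
`two_logb_add_le`, and its height can only help. The variables `H₁`, `H₂` stand for height plus one.
-/
theorem log_ratio_bound_merge {n₁ n₂ H₁ H₂ δ₁ δ₂ : ℝ} (hn₁ : 2 ≤ n₁) (hn₂ : 2 ≤ n₂)
    (hH₁ : 1 ≤ H₁) (hH₂ : 1 ≤ H₂)
    (hw₁ : Real.logb 2 n₁ / 2 ≤ δ₁) (hw₂ : Real.logb 2 n₂ / 2 ≤ δ₂)
    (h₁ : 2 * Real.logb 2 n₁ - Real.logb 2 H₁ - 16 ≤ δ₁)
    (h₂ : 2 * Real.logb 2 n₂ - Real.logb 2 H₂ - 16 ≤ δ₂) :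
    2 * Real.logb 2 (n₁ + n₂ - 1) - Real.logb 2 (max H₁ H₂) - 16 ≤ δ₁ + δ₂ := by
  wlog h : n₂ ≤ n₁ generalizing n₁ n₂ H₁ H₂ δ₁ δ₂
  · have := this hn₂ hn₁ hH₂ hH₁ hw₂ hw₁ h₂ h₁ (le_of_not_ge h)
    rwa [max_comm, add_comm n₁, add_comm δ₁]
  have hm : Real.logb 2 H₁ ≤ Real.logb 2 (max H₁ H₂) :=
    Real.logb_le_logb_of_le one_lt_two (by linarith) (le_max_left _ _)
  have h0 := Real.logb_nonneg one_lt_two hH₁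
  have h3 := Real.logb_nonneg one_lt_two (x := n₁) (by linarith)
  have h4 := Real.logb_nonneg one_lt_two (x := n₂) (by linarith)
  rw [add_sub_assoc]
  rcases two_logb_add_le (x := n₁) (y := n₂ - 1) (δ := δ₂) (by linarith) (by linarith)
    (by linarith) (by simpa using hw₂) with h' | h' <;> linarith

/-- If the order exceeds twice the height plus one, the left side does not grow. Otherwise order and
height are comparable, and `log (n + 1) - 15` is a sufficient lower bound. It holds outright if the
deficiency exceeds `n / 2` or if `N` is of order at least `n ^ 2`. In the remaining case the stem
gain `(n - δ) / (1 + N)` covers the growth of the left side. -/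
theorem log_ratio_bound_stem {t : PlaneTree}
    (h : 2 * Real.logb 2 t.order - Real.logb 2 (t.height + 1) - 16 ≤ t.deficiency) :
    2 * Real.logb 2 (t.order + 1) - Real.logb 2 (t.height + 2) - 16 ≤ t.stemDeficiency := by
  have hn : (1 : ℝ) ≤ t.order := by exact_mod_cast t.one_le_order
  have hH : (t.height : ℝ) + 1 ≤ t.order := by exact_mod_cast t.height_lt_order
  have hs := t.deficiency_le_stemDeficiency
  have hd := t.stemDeficiency_sub
  have hN := t.half_logb_le_stemDeficiency
  have hN0 := t.rootedCount_pos
  have hh : (0 : ℝ) ≤ t.height := Nat.cast_nonneg _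
  -- Integrality matters: the strict inequality alone would not give `(2 * n + 1) * (k + 1) ≤ n ^ 2`
  -- below.
  have hgap : 2 * ((t.height : ℝ) + 1) < t.order → 2 * ((t.height : ℝ) + 1) + 1 ≤ t.order := by
    intro hc
    have : 2 * (t.height + 1) < t.order := by exact_mod_cast hc
    exact_mod_cast this
  set n : ℝ := (t.order : ℝ)
  set k : ℝ := (t.height : ℝ)
  set δ := t.deficiency
  set N := t.rootedCount
  have e1 : Real.logb 2 (n + 1) = Real.logb 2 n + Real.logb 2 (1 + 1 / n) := by
    rw [← Real.logb_mul (by linarith) (by positivity)]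
    congr 1
    field_simp
  have e2 : Real.logb 2 (k + 2) = Real.logb 2 (k + 1) + Real.logb 2 (1 + 1 / (k + 1)) := by
    rw [← Real.logb_mul (by linarith) (by positivity)]
    congr 1
    field_simp
    ring
  rcases lt_or_ge (2 * (k + 1)) n with hc | hc
  · have hc' := hgap hc
    have : 2 * Real.logb 2 (1 + 1 / n) ≤ Real.logb 2 (1 + 1 / (k + 1)) := by
      have e : 2 * Real.logb 2 (1 + 1 / n) = Real.logb 2 ((1 + 1 / n) ^ 2) := by
        rw [Real.logb_pow]; norm_num
      rw [e]
      refine Real.logb_le_logb_of_le one_lt_two (by positivity) ?_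
      have : (2 * n + 1) / n ^ 2 ≤ 1 / (k + 1) := by
        rw [div_le_div_iff₀ (by positivity) (by positivity)]
        nlinarith
      calc (1 + 1 / n) ^ 2 = 1 + (2 * n + 1) / n ^ 2 := by field_simp; ring
        _ ≤ _ := by linarith
    linarith
  have h1 : Real.logb 2 (n + 1) ≤ Real.logb 2 (k + 2) + 1 := by
    have : Real.logb 2 (2 * (k + 2)) = 1 + Real.logb 2 (k + 2) := by
      rw [Real.logb_mul two_ne_zero (by linarith), Real.logb_self_eq_one one_lt_two]
    have h2 := Real.logb_le_logb_of_le one_lt_two (x := n + 1) (y := 2 * (k + 2))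
      (by linarith) (by linarith)
    linarith
  have h1n : Real.logb 2 (1 + 1 / n) ≤ 1 := by
    have : 1 / n ≤ 1 := by rw [div_le_one (by linarith)]; exact hn
    have h2 := Real.logb_le_logb_of_le one_lt_two (x := 1 + 1 / n) (y := 2)
      (by positivity) (by linarith)
    rwa [Real.logb_self_eq_one one_lt_two] at h2
  rcases lt_or_ge (n / 2) δ with hδ | hδ
  · have : Real.logb 2 (n + 1) ≤ n / 2 + 8 := by
      -- Dividing by 4 first lowers the slope of the linear bound from `3 / 2` to `3 / 8`, below `1
      -- / 2`.
      have e : Real.logb 2 (n + 1) = Real.logb 2 ((n + 1) / 4) + 2 := by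
        rw [show n + 1 = (n + 1) / 4 * 2 ^ 2 by ring, Real.logb_mul (by positivity) (by norm_num),
          Real.logb_pow, Real.logb_self_eq_one one_lt_two]
        norm_num
      rcases le_or_gt 1 ((n + 1) / 4) with h2 | h2
      · linarith [logb_two_le h2]
      · have := Real.logb_nonpos one_lt_two (by linarith : 0 ≤ (n + 1) / 4) h2.le
        linarith
    linarith
  rcases le_or_gt (1 + N) (n ^ 2 / 3) with hc2 | hc2
  · have h2 : 3 / 2 * (1 / n) ≤ (n - δ) / (1 + N) := by
      rw [le_div_iff₀ (by linarith)]
      calc 3 / 2 * (1 / n) * (1 + N) ≤ 3 / 2 * (1 / n) * (n ^ 2 / 3) := by gcongr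
        _ = n / 2 := by field_simp
        _ ≤ _ := by linarith
    have h3 := logb_one_add_le (x := 1 / n) (by positivity)
    have h4 : Real.logb 2 (1 + 1 / n) ≤ Real.logb 2 (1 + 1 / (k + 1)) := by
      refine Real.logb_le_logb_of_le one_lt_two (by positivity) ?_
      gcongr
    linarith
  · have h2 : 2 * Real.logb 2 n ≤ Real.logb 2 (1 + N) + 2 := by
      have e : 2 * Real.logb 2 n = Real.logb 2 (n ^ 2 / 4) + 2 := by
        rw [Real.logb_div (by positivity) (by norm_num), Real.logb_pow,
          show (4 : ℝ) = 2 ^ 2 by norm_num, Real.logb_pow, Real.logb_self_eq_one one_lt_two]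
        norm_num
      rw [e]
      have := Real.logb_le_logb_of_le one_lt_two (x := n ^ 2 / 4) (y := 1 + N) (by positivity)
        (by nlinarith)
      linarith
    linarith

theorem log_ratio_bound (t : PlaneTree) :
    2 * Real.logb 2 t.order - Real.logb 2 (t.height + 1) - 16 ≤ t.deficiency := by
  induction t with
  | single => norm_num [order, height, deficiency]
  | join a b ha hb =>
    have hs := log_ratio_bound_stem hb
    have hb1 : (1 : ℝ) ≤ b.order := by exact_mod_cast b.one_le_order
    -- The tree is `a` merged with the stemmed `b`. If `a` is one vertex there is only the stem, and
    -- the merge estimate, which needs order at least 2, does not apply.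
    rcases a with _ | ⟨c, d⟩
    · rw [deficiency_single_join]
      have e : (b.height : ℝ) + 1 + 1 = b.height + 2 := by ring
      simpa [order, height, e, add_comm 1 (b.order : ℝ)] using hs
    · have hc1 : (1 : ℝ) ≤ c.order := by exact_mod_cast c.one_le_order
      have hd1 : (1 : ℝ) ≤ d.order := by exact_mod_cast d.one_le_order
      have := log_ratio_bound_merge (by simp only [order]; push_cast; linarith) (by linarith)
        (by linarith [Nat.cast_nonneg (α := ℝ) (join c d).height])
        (by linarith [Nat.cast_nonneg (α := ℝ) b.height])
        (half_logb_order_le _) (half_logb_order_succ_le _) ha hs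
      rw [deficiency_join (join c d) b]
      refine le_trans (le_of_eq ?_) this
      rw [order.eq_2 (join c d) b, height.eq_2 (join c d) b]
      push_cast
      rw [← max_add_add_right, add_assoc (b.height : ℝ), one_add_one_eq_two, ← add_assoc,
        add_sub_cancel_right]

theorem logb_order_le (t : PlaneTree) : Real.logb 2 t.order - 16 ≤ t.deficiency := by
  have hH : (t.height : ℝ) + 1 ≤ t.order := by exact_mod_cast t.height_lt_order
  have := Real.logb_le_logb_of_le one_lt_two
    (by linarith [Nat.cast_nonneg (α := ℝ) t.height]) hH
  linarith [t.log_ratio_bound]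

/-! ### Deficiency against order minus height. -/

theorem log_excess_bound_merge {n₁ n₂ h₁ h₂ δ₁ δ₂ : ℝ} (hn₁ : 2 ≤ n₁) (hn₂ : 2 ≤ n₂)
    (hh₁ : 0 ≤ h₁) (hh₂ : 0 ≤ h₂) (hhn₁ : h₁ + 1 ≤ n₁) (hhn₂ : h₂ + 1 ≤ n₂)
    (hw₁ : Real.logb 2 n₁ / 2 ≤ δ₁) (hw₂ : Real.logb 2 n₂ / 2 ≤ δ₂)
    (hr₁ : 2 * Real.logb 2 n₁ - Real.logb 2 (h₁ + 1) - 16 ≤ δ₁)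
    (hr₂ : 2 * Real.logb 2 n₂ - Real.logb 2 (h₂ + 1) - 16 ≤ δ₂)
    (hx₁ : 2 * Real.logb 2 (n₁ - h₁) - 34 ≤ δ₁) (hx₂ : 2 * Real.logb 2 (n₂ - h₂) - 34 ≤ δ₂) :
    2 * Real.logb 2 (n₁ + n₂ - 1 - max h₁ h₂) - 34 ≤ δ₁ + δ₂ := by
  wlog h : h₂ ≤ h₁ generalizing n₁ n₂ h₁ h₂ δ₁ δ₂
  · have := this hn₂ hn₁ hh₂ hh₁ hhn₂ hhn₁ hw₂ hw₁ hr₂ hr₁ hx₂ hx₁ (le_of_not_ge h)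
    rwa [max_comm, add_comm n₁, add_comm δ₁]
  rw [max_eq_left h, show n₁ + n₂ - 1 - h₁ = (n₁ - h₁) + (n₂ - 1) by ring]
  have h3 := Real.logb_nonneg one_lt_two (x := n₁) (by linarith)
  have h4 := Real.logb_nonneg one_lt_two (x := n₂) (by linarith)
  rcases le_or_gt (n₂ - 1) (n₁ - h₁) with hc | hc
  · rcases two_logb_add_le (x := n₁ - h₁) (y := n₂ - 1) (δ := δ₂) (by linarith) (by linarith)
      hc (by simpa using hw₂) with h' | h' <;> linarith
  -- Here the excess is below `2 * n₂`. The ratio bound for the second part gives `2 log n₂ ≤ δ₂ +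
  -- log (h₂ + 1) + 16`, and `log (h₂ + 1) ≤ log n₁ ≤ δ₁ + 16` by that for the first. This yields
  -- `34 = 2 + 16 + 16`.
  · have h5 := Real.logb_le_logb_of_le one_lt_two (x := h₁ + 1) (by linarith) hhn₁
    have h6 := Real.logb_le_logb_of_le one_lt_two (x := h₂ + 1) (y := n₁) (by linarith)
      (by linarith)
    have h7 := Real.logb_le_logb_of_le one_lt_two (x := (n₁ - h₁) + (n₂ - 1)) (y := 2 * n₂)
      (by linarith) (by linarith)
    rw [Real.logb_mul two_ne_zero (by linarith), Real.logb_self_eq_one one_lt_two] at h7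
    linarith

theorem log_excess_bound (t : PlaneTree) :
    2 * Real.logb 2 (t.order - t.height) - 34 ≤ t.deficiency := by
  induction t with
  | single => norm_num [order, height, deficiency]
  | join a b ha hb =>
    have hb1 : (1 : ℝ) ≤ b.order := by exact_mod_cast b.one_le_order
    -- A stem raises order and height by one each, so their difference is unchanged.
    have hs := hb.trans b.deficiency_le_stemDeficiency
    rcases a with _ | ⟨c, d⟩
    · rw [deficiency_single_join]
      simpa [order, height, add_comm] using hs
    · have hc1 : (1 : ℝ) ≤ c.order := by exact_mod_cast c.one_le_order
      have hd1 : (1 : ℝ) ≤ d.order := by exact_mod_cast d.one_le_order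
      have hr := log_ratio_bound_stem b.log_ratio_bound
      have := log_excess_bound_merge (n₂ := b.order + 1) (h₂ := b.height + 1)
        (by simp only [order]; push_cast; linarith) (by linarith)
        (Nat.cast_nonneg (join c d).height) (by positivity)
        (by exact_mod_cast (join c d).height_lt_order)
        (by have : (b.height : ℝ) + 1 ≤ b.order := by exact_mod_cast b.height_lt_order
            linarith)
        (half_logb_order_le _) (half_logb_order_succ_le _) (log_ratio_bound _)
        (by rwa [add_assoc (b.height : ℝ), one_add_one_eq_two])
        ha (by rwa [add_sub_add_right_eq_sub])
      rw [deficiency_join (join c d) b]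
      refine le_trans (le_of_eq ?_) this
      rw [order.eq_2 (join c d) b, height.eq_2 (join c d) b]
      push_cast
      rw [← add_assoc, add_sub_cancel_right]

end PlaneTree

/-! ### All subtrees versus rooted ones, and the choice of a root. -/

namespace PlaneTree

theorem rootedCount_le_count (t : PlaneTree) : t.rootedCount ≤ t.count := by
  induction t with
  | single => simp [count, rootedCount]
  | join a b ha hb =>
    simp only [count, rootedCount]
    linarith [b.rootedCount_pos]

theorem count_pos (t : PlaneTree) : 0 < t.count :=
  t.rootedCount_pos.trans_le t.rootedCount_le_count

/-- The mean order of all subtrees is at most the mean order of those containing the root. -/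
theorem total_le (t : PlaneTree) : t.total ≤ (t.order - t.deficiency) * t.count := by
  induction t with
  | single => simp [total, count, order, deficiency]
  | join a b ha hb =>
    have hNb := b.one_le_rootedCount
    have hna := a.rootedCount_pos
    have h1 := b.order_le_rootedCount
    have h2 := b.deficiency_le
    have hd : 0 ≤ b.deficiency := le_trans
      (div_nonneg (Real.logb_nonneg one_lt_two hNb) two_pos.le) b.half_logb_rootedCount_le
    have h3 : (1 : ℝ) ≤ a.order - a.deficiency := by
      linarith [a.deficiency_le_sub_one]
    simp only [total, count, rootedTotal_eq, order, deficiency]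
    push_cast
    set M := b.rootedCount
    set N := a.rootedCount
    set x := (a.order : ℝ) - a.deficiency with hx
    set y := (b.order : ℝ) - b.deficiency with hy
    have e : (a.order : ℝ) + b.order - (a.deficiency + (M * b.deficiency + b.order) / (1 + M))
        = x + M / (1 + M) * y := by
      rw [hx, hy]; field_simp; ring
    rw [e]
    set r := M / (1 + M) with hr
    have hr1 : (1 - r) * (1 + M) = 1 := by rw [hr]; field_simp; ring
    have hr0 : 0 ≤ r := by positivity
    have hrM : M * (1 - r) = r := by rw [hr]; field_simp; ring
    have hy0 : 0 ≤ y := by linarith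
    -- The mean `y` over rooted subtrees of `b` is at most its order, hence at most `M`, so `(1 - r)
    -- * y ≤ 1 ≤ x`. Thus subtrees inside `b` do not exceed the new rooted mean `x + r * y`.
    have hyx : y ≤ x + r * y := by
      have : (1 - r) * y ≤ (1 - r) * (1 + M) :=
        mul_le_mul_of_nonneg_left (by linarith) (by nlinarith)
      linarith
    have hF := a.rootedCount_le_count
    have hFb := b.count_pos
    have k1 : y * b.count ≤ (x + r * y) * b.count := by gcongr
    have k2 : N * (r * y) ≤ a.count * (r * y) := by gcongr
    have k3 : N * x * M + N * (M * y) = (x + r * y) * (N * M) + N * (r * y) := by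
      linear_combination (N * y) * hrM
    nlinarith

/-- Identify the roots of two trees. -/
def merge (x : PlaneTree) : PlaneTree → PlaneTree
  | single => x
  | join a b => join (merge x a) b

section merge

variable (x y : PlaneTree)

theorem order_merge : (merge x y).order + 1 = x.order + y.order := by
  induction y with
  | single => rfl
  | join a b ha hb => simp only [merge, order]; omega

theorem height_merge : (merge x y).height = max x.height y.height := by
  induction y with
  | single => simp [merge, height]
  | join a b ha hb => simp only [merge, height]; omega

theorem diam_merge :
    (merge x y).diam = max (max x.diam y.diam) (x.height + y.height) := by
  have h (t : PlaneTree) : t.height ≤ t.diam := by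
    induction t with
    | single => rfl
    | join a b ha hb => simp only [height, diam]; omega
  induction y with
  | single => have := h x; simp [merge, height, diam, this]
  | join a b ha hb => simp only [merge, height, diam, height_merge]; omega

theorem rootedCount_merge : (merge x y).rootedCount = x.rootedCount * y.rootedCount := by
  induction y with
  | single => simp [merge, rootedCount]
  | join a b ha hb => simp only [merge, rootedCount, ha]; ring

theorem rootedTotal_merge : (merge x y).rootedTotal =
    x.rootedTotal * y.rootedCount + x.rootedCount * y.rootedTotal
      - x.rootedCount * y.rootedCount := by
  induction y with
  | single => simp [merge, rootedCount, rootedTotal]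
  | join a b ha hb => simp only [merge, rootedCount, rootedTotal, ha, rootedCount_merge]; ring

theorem count_merge : (merge x y).count =
    x.count + y.count - x.rootedCount - y.rootedCount + x.rootedCount * y.rootedCount := by
  induction y with
  | single => simp [merge, rootedCount, count]; ring
  | join a b ha hb => simp only [merge, rootedCount, count, ha, rootedCount_merge]; ring

theorem total_merge : (merge x y).total =
    x.total + y.total - x.rootedTotal - y.rootedTotal
      + (x.rootedTotal * y.rootedCount + x.rootedCount * y.rootedTotal
        - x.rootedCount * y.rootedCount) := by
  induction y with
  | single => simp [merge, rootedCount, rootedTotal, total]; ring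
  | join a b ha hb =>
    simp only [merge, rootedCount, rootedTotal, total, ha, rootedCount_merge, rootedTotal_merge]
    ring

theorem deficiency_merge : (merge x y).deficiency = x.deficiency + y.deficiency := by
  induction y with
  | single => simp [merge, deficiency]
  | join a b ha hb => simp only [merge, deficiency, ha]; ring

end merge

/-- The two plane trees have the same order, diameter, and number and total order of subtrees. -/
structure SameProfile (s t : PlaneTree) : Prop where
  order : s.order = t.order
  diam : s.diam = t.diam
  count : s.count = t.count
  total : s.total = t.total

theorem SameProfile.trans {r s t : PlaneTree} (h : SameProfile r s) (h' : SameProfile s t) :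
    SameProfile r t :=
  ⟨h.1.trans h'.1, h.2.trans h'.2, h.3.trans h'.3, h.4.trans h'.4⟩

theorem sameProfile_merge_comm (x y : PlaneTree) : SameProfile (merge x y) (merge y x) where
  order := by have := order_merge x y; have := order_merge y x; omega
  diam := by simp only [diam_merge]; omega
  count := by simp only [count_merge]; ring
  total := by simp only [total_merge]; ring

/-- The split vertex stays and the branch `b` changes sides. -/
theorem sameProfile_merge_join_left (x a b : PlaneTree) :
    SameProfile (merge (join x b) a) (merge x (join a b)) where
  order := by
    have := order_merge (join x b) a
    have := order_merge x (join a b)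
    simp only [PlaneTree.order] at *
    omega
  diam := by simp only [diam_merge, PlaneTree.diam, height]; omega
  count := by simp only [count_merge, PlaneTree.count, rootedCount]; ring
  total := by simp only [total_merge, PlaneTree.total, rootedCount, rootedTotal]; ring

/-- The split vertex moves along an edge to the root of `b`. -/
theorem sameProfile_merge_stem (x a b : PlaneTree) :
    SameProfile (merge (join single (merge x a)) b) (merge x (join a b)) where
  order := by
    have := order_merge (join single (merge x a)) b
    have := order_merge x (join a b)
    have := order_merge x a
    simp only [PlaneTree.order] at *
    omega
  diam := by simp only [diam_merge, merge, PlaneTree.diam, height]; omega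
  count := by simp only [count_merge, merge, PlaneTree.count, rootedCount]; ring
  total := by simp only [total_merge, merge, PlaneTree.total, rootedCount, rootedTotal]; ring

/-- Up to the choice of the root, every tree splits at a vertex into two parts, each of
which has at least a third of the vertices. -/
theorem exists_balanced_merge (t : PlaneTree) :
    ∃ x y, SameProfile (merge x y) t ∧ t.order ≤ 3 * x.order ∧ t.order ≤ 3 * y.order := by
  suffices H : ∀ m : ℕ, ∀ x y, SameProfile (merge x y) t → max x.order y.order ≤ m →
      ∃ x y, SameProfile (merge x y) t ∧ t.order ≤ 3 * x.order ∧ t.order ≤ 3 * y.order from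
    H _ t single ⟨rfl, rfl, rfl, rfl⟩ le_rfl
  intro m
  induction m with
  | zero => intro x y _ h; have := x.one_le_order; omega
  | succ m ih =>
    intro x y hxy hm
    wlog hle : x.order ≤ y.order generalizing x y
    · exact this y x ((sameProfile_merge_comm y x).trans hxy) (by omega) (by omega)
    have ht := hxy.order
    have hm1 := order_merge x y
    by_cases h3 : t.order ≤ 3 * x.order
    · exact ⟨x, y, hxy, h3, by omega⟩
    rcases y with _ | ⟨a, b⟩
    · simp only [order] at *; omega
    have ha := a.one_le_order
    have hb := b.one_le_order
    -- Either move makes the larger part smaller. In the second case `a.order ≤ x.order`, and since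
    -- `x` has under a third of the vertices, `x.order < b.order`.
    by_cases hxa : x.order < a.order
    · refine ih (join x b) a ((sameProfile_merge_join_left x a b).trans hxy) ?_
      simp only [order] at *
      omega
    · refine ih (join single (merge x a)) b ((sameProfile_merge_stem x a b).trans hxy) ?_
      have := order_merge x a
      simp only [order] at *
      omega

theorem diam_lt_order (t : PlaneTree) : t.diam < t.order := by
  induction t with
  | single => simp [order, diam]
  | join a b ha hb =>
    have := a.height_lt_order
    have := b.height_lt_order
    simp only [order, diam]; omega

/-- The constant is `54 = 16 + 34 + 2 + 2`, the last two terms coming from the factors 3 (rounded up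
to 4) and 2 in the hypotheses. -/
theorem mean_le_of_merge {x y t : PlaneTree} (h : SameProfile (merge x y) t)
    (hx : t.order ≤ 3 * x.order)
    (hy : t.order + 1 ≤ t.diam + 2 * (y.order - y.height)) :
    t.total / t.count ≤ t.order - Real.logb 2 t.order
      - 2 * Real.logb 2 (t.order - t.diam) + 54 := by
  have h1 : (1 : ℝ) ≤ t.order := by exact_mod_cast t.one_le_order
  have h2 : (1 : ℝ) ≤ x.order := by exact_mod_cast x.one_le_order
  have h3 : (y.height : ℝ) + 1 ≤ y.order := by exact_mod_cast y.height_lt_order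
  have h4 : (t.diam : ℝ) + 1 ≤ t.order := by exact_mod_cast t.diam_lt_order
  have hx' : (t.order : ℝ) ≤ 3 * x.order := by exact_mod_cast hx
  have hy' : (t.order : ℝ) - t.diam ≤ 2 * (y.order - y.height) := by
    have : t.order + 2 * y.height ≤ t.diam + 2 * y.order := by
      have := y.height_lt_order
      omega
    have : (t.order : ℝ) + 2 * y.height ≤ t.diam + 2 * y.order := by exact_mod_cast this
    linarith
  have hm : t.total / t.count ≤ t.order - (x.deficiency + y.deficiency) := by
    rw [div_le_iff₀ t.count_pos, ← deficiency_merge, ← h.order, ← h.total, ← h.count]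
    exact total_le _
  have l2 : Real.logb 2 (2 : ℝ) = 1 := Real.logb_self_eq_one one_lt_two
  have h5 : Real.logb 2 t.order ≤ 2 + Real.logb 2 x.order := by
    have := Real.logb_le_logb_of_le one_lt_two (x := (t.order : ℝ)) (y := 2 ^ 2 * x.order)
      (by linarith) (by linarith)
    rwa [Real.logb_mul (by norm_num) (by linarith), Real.logb_pow, l2, Nat.cast_ofNat,
      mul_one] at this
  have h6 := Real.logb_le_logb_of_le one_lt_two (by linarith) hy'
  rw [Real.logb_mul two_ne_zero (by linarith), l2] at h6
  linarith [x.logb_order_le, y.log_excess_bound]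

theorem mean_le (t : PlaneTree) :
    t.total / t.count ≤ t.order - Real.logb 2 t.order
      - 2 * Real.logb 2 (t.order - t.diam) + 54 := by
  obtain ⟨x, y, h, hx, hy⟩ := exists_balanced_merge t
  have h1 := order_merge x y
  have h2 := diam_merge x y
  rw [h.order] at h1
  rw [h.diam] at h2
  have h3 := x.height_lt_order
  have h4 := y.height_lt_order
  -- The two values of order minus height sum to at least `t.order + 1 - t.diam`, so one of them is
  -- at least half of that.
  by_cases hc : t.order + 1 ≤ t.diam + 2 * (y.order - y.height)
  · exact mean_le_of_merge h hx hc
  · exact mean_le_of_merge ((sameProfile_merge_comm y x).trans h) hy (by omega)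

end PlaneTree

/-! ### Connected vertex sets and subtrees across a single edge. -/

section InnerConnected

variable {V : Type*} {T : SimpleGraph V}

/-- The relation of being joined by a walk inside `S`. -/
def InnerReachable (T : SimpleGraph V) (S : Finset V) : V → V → Prop :=
  Relation.ReflTransGen fun x y => T.Adj x y ∧ x ∈ S ∧ y ∈ S

/-- Any two vertices of `S` are joined by a walk inside `S`. -/
def InnerConnected (T : SimpleGraph V) (S : Finset V) : Prop :=
  ∀ x ∈ S, ∀ y ∈ S, InnerReachable T S x y

theorem InnerReachable.symm {S : Finset V} {x y : V} (h : InnerReachable T S x y) :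
    InnerReachable T S y x := by
  induction h with
  | refl => exact .refl
  | tail _ h ih => exact ih.head ⟨h.1.symm, h.2.2, h.2.1⟩

theorem InnerReachable.mono {S S' : Finset V} (hS : S ⊆ S') {x y : V}
    (h : InnerReachable T S x y) : InnerReachable T S' x y :=
  Relation.ReflTransGen.mono (fun _ _ h => ⟨h.1, hS h.2.1, hS h.2.2⟩) _ _ h

theorem innerConnected_of_root {S : Finset V} (v : V)
    (h : ∀ x ∈ S, InnerReachable T S v x) : InnerConnected T S :=
  fun x hx y hy => (h x hx).symm.trans (h y hy)

theorem isTree_induce_iff (hT : T.IsAcyclic) (S : Finset V) :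
    (T.induce (S : Set V)).IsTree ↔ S.Nonempty ∧ InnerConnected T S := by
  constructor
  · intro h
    obtain ⟨x, hx⟩ := h.nonempty
    refine ⟨⟨x, hx⟩, fun x hx y hy => ?_⟩
    have := h.preconnected ⟨x, hx⟩ ⟨y, hy⟩
    rw [SimpleGraph.reachable_iff_reflTransGen] at this
    exact Relation.ReflTransGen.lift' (p := fun x y => T.Adj x y ∧ x ∈ S ∧ y ∈ S) Subtype.val
      (fun a b hab => .single ⟨hab, a.2, b.2⟩) _ _ this
  · rintro ⟨⟨v, hv⟩, h⟩
    have : Nonempty (S : Set V) := ⟨⟨v, hv⟩⟩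
    refine ⟨⟨?_⟩, hT.induce _⟩
    rintro ⟨x, hx⟩ ⟨y, hy⟩
    have key : ∀ y, InnerReachable T S x y → ∀ hy : y ∈ S,
        (T.induce (S : Set V)).Reachable ⟨x, hx⟩ ⟨y, hy⟩ := by
      intro y hxy
      induction hxy with
      | refl => exact fun _ => .rfl
      | tail _ hab ih =>
        exact fun hy => (ih hab.2.1).trans (SimpleGraph.Adj.reachable (by simpa using hab.1))
    exact key y (h x hx y hy) hy

theorem mem_subtrees [Fintype V] (hT : T.IsAcyclic) {S : Finset V} :
    S ∈ subtrees T ↔ S.Nonempty ∧ InnerConnected T S := by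
  simp only [subtrees, Finset.mem_filter, Finset.mem_univ, true_and, isTree_induce_iff hT]

/-- `vu` is the only edge between the disjoint vertex sets `A ∋ v` and `B ∋ u`. -/
structure OnlyEdge (T : SimpleGraph V) (A B : Finset V) (v u : V) : Prop where
  disjoint : Disjoint A B
  left_mem : v ∈ A
  right_mem : u ∈ B
  adj : T.Adj v u
  eq_of_adj : ∀ x ∈ A, ∀ y ∈ B, T.Adj x y → x = v ∧ y = u

namespace OnlyEdge

variable {A B S S₁ S₂ : Finset V} {v u : V}

theorem symm (h : OnlyEdge T A B v u) : OnlyEdge T B A u v :=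
  ⟨h.disjoint.symm, h.right_mem, h.left_mem, h.adj.symm,
    fun x hx y hy hxy => (h.eq_of_adj y hy x hx hxy.symm).symm⟩

theorem not_mem_right (h : OnlyEdge T A B v u) {x : V} (hx : x ∈ A) : x ∉ B :=
  Finset.disjoint_left.1 h.disjoint hx

/-- A second edge between `A` and `B` would bypass `vu`, but every edge of an acyclic graph is a
bridge. -/
theorem of_isAcyclic (hT : T.IsAcyclic) (hAB : Disjoint A B) (hv : v ∈ A) (hu : u ∈ B)
    (hA : InnerConnected T A) (hB : InnerConnected T B) (hvu : T.Adj v u) :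
    OnlyEdge T A B v u := by
  refine ⟨hAB, hv, hu, hvu, fun x hx y hy hxy => ?_⟩
  by_contra hne
  refine SimpleGraph.isBridge_iff.1 (SimpleGraph.isAcyclic_iff_forall_adj_isBridge.1 hT hvu) ?_
  have huA : u ∉ A := Finset.disjoint_right.1 hAB hu
  have hvB : v ∉ B := Finset.disjoint_left.1 hAB hv
  have hyA : y ∉ A := Finset.disjoint_right.1 hAB hy
  have key : ∀ D : Finset V, (v ∉ D ∨ u ∉ D) → ∀ a b, InnerReachable T D a b →
      (T.deleteEdges {s(v, u)}).Reachable a b := by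
    intro D hD a b hab
    rw [SimpleGraph.reachable_iff_reflTransGen]
    refine Relation.ReflTransGen.mono (fun c d hcd => ?_) _ _ hab
    rw [SimpleGraph.deleteEdges_adj]
    refine ⟨hcd.1, fun hs => ?_⟩
    rw [Set.mem_singleton_iff, Sym2.eq_iff] at hs
    rcases hs with ⟨rfl, rfl⟩ | ⟨rfl, rfl⟩
    · exact hD.elim (· hcd.2.1) (· hcd.2.2)
    · exact hD.elim (· hcd.2.2) (· hcd.2.1)
  refine ((key A (.inr huA) v x (hA v hv x hx)).trans (SimpleGraph.Adj.reachable ?_)).trans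
    (key B (.inl hvB) y u (hB y hy u hu))
  rw [SimpleGraph.deleteEdges_adj]
  refine ⟨hxy, fun hs => ?_⟩
  rw [Set.mem_singleton_iff, Sym2.eq_iff] at hs
  rcases hs with hs | ⟨rfl, rfl⟩
  · exact hne hs
  · exact huA hx

variable [DecidableEq V]

theorem innerConnected_union (h : OnlyEdge T A B v u) (h₁ : InnerConnected T S₁)
    (h₂ : InnerConnected T S₂) (hv : v ∈ S₁) (hu : u ∈ S₂) : InnerConnected T (S₁ ∪ S₂) := by
  refine innerConnected_of_root v fun x hx => ?_
  rcases Finset.mem_union.1 hx with hx | hx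
  · exact (h₁ v hv x hx).mono Finset.subset_union_left
  · refine Relation.ReflTransGen.head ⟨h.adj, ?_, ?_⟩
      ((h₂ u hu x hx).mono Finset.subset_union_right)
    · exact Finset.mem_union_left _ hv
    · exact Finset.mem_union_right _ hu

theorem mem_of_crossing (h : OnlyEdge T A B v u) (hS : S ⊆ A ∪ B) {x y : V}
    (hxy : InnerReachable T S x y) (hx : x ∈ A) (hy : y ∈ B) : v ∈ S ∧ u ∈ S := by
  by_contra hvu
  suffices y ∈ A from h.not_mem_right this hy
  clear hy
  induction hxy with
  | refl => exact hx
  | @tail b c _ hbc ih =>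
    rcases Finset.mem_union.1 (hS hbc.2.2) with hc | hc
    · exact hc
    · obtain ⟨rfl, rfl⟩ := h.eq_of_adj b ih c hc hbc.1
      exact absurd hbc.2 hvu

theorem innerConnected_inter (h : OnlyEdge T A B v u) (hS : S ⊆ A ∪ B) (hc : InnerConnected T S)
    (hv : v ∈ S) : InnerConnected T (S ∩ A) := by
  refine innerConnected_of_root v fun x hx => ?_
  -- Retract walks to `A` by collapsing all of `B` to `v`; the only crossing edge becomes
  -- stationary.
  have := Relation.ReflTransGen.lift' (r := fun x y => T.Adj x y ∧ x ∈ S ∧ y ∈ S)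
    (p := fun x y => T.Adj x y ∧ x ∈ S ∩ A ∧ y ∈ S ∩ A)
    (fun x => if x ∈ A then x else v) (fun a b hab => ?_) _ _
    (hc v hv x (Finset.mem_of_mem_inter_left hx))
  · simpa only [InnerReachable, Function.onFun, h.left_mem, Finset.mem_of_mem_inter_right hx,
      if_true] using this
  · obtain ⟨hab, ha, hb⟩ := hab
    by_cases haA : a ∈ A <;> by_cases hbA : b ∈ A
    · simpa [Function.onFun, haA, hbA] using
        Relation.ReflTransGen.single ⟨hab, ⟨ha, haA⟩, ⟨hb, hbA⟩⟩
    · have hbB := (Finset.mem_union.1 (hS hb)).resolve_left hbA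
      obtain ⟨rfl, -⟩ := h.eq_of_adj a haA b hbB hab
      simp [Function.onFun, hbA, Relation.ReflTransGen.refl]
    · have haB := (Finset.mem_union.1 (hS ha)).resolve_left haA
      obtain ⟨rfl, -⟩ := h.eq_of_adj b hbA a haB hab.symm
      simp [Function.onFun, haA, Relation.ReflTransGen.refl]
    · simp [Function.onFun, haA, hbA, Relation.ReflTransGen.refl]

theorem subset_left_or_right (h : OnlyEdge T A B v u) {S : Finset V} (hS : S ⊆ A ∪ B)
    (hc : InnerConnected T S) : S ⊆ A ∨ S ⊆ B ∨ v ∈ S ∧ u ∈ S := by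
  by_cases hA : S ⊆ A
  · exact .inl hA
  by_cases hB : S ⊆ B
  · exact .inr (.inl hB)
  obtain ⟨y, hy, hyA⟩ := Finset.not_subset.1 hA
  obtain ⟨x, hx, hxB⟩ := Finset.not_subset.1 hB
  exact .inr (.inr (h.mem_of_crossing hS (hc x hx y hy)
    ((Finset.mem_union.1 (hS hx)).resolve_right hxB)
    ((Finset.mem_union.1 (hS hy)).resolve_left hyA)))

theorem union_inter_left (h : OnlyEdge T A B v u) (h₁ : S₁ ⊆ A) (h₂ : S₂ ⊆ B) :
    (S₁ ∪ S₂) ∩ A = S₁ := by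
  rw [Finset.union_inter_distrib_right, Finset.inter_eq_left.2 h₁,
    Finset.disjoint_iff_inter_eq_empty.1 (h.disjoint.symm.mono_left h₂), Finset.union_empty]

theorem union_inter_right (h : OnlyEdge T A B v u) (h₁ : S₁ ⊆ A) (h₂ : S₂ ⊆ B) :
    (S₁ ∪ S₂) ∩ B = S₂ := by
  rw [Finset.union_comm, h.symm.union_inter_left h₂ h₁]

end OnlyEdge

variable [Fintype V]

open scoped Classical in
/-- The subtrees with all vertices in `A`. -/
noncomputable def subtreesIn (T : SimpleGraph V) (A : Finset V) : Finset (Finset V) :=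
  (subtrees T).filter (· ⊆ A)

open scoped Classical in
/-- The subtrees with all vertices in `A` that contain `v`. -/
noncomputable def subtreesAt (T : SimpleGraph V) (A : Finset V) (v : V) : Finset (Finset V) :=
  (subtreesIn T A).filter (v ∈ ·)

theorem mem_subtreesIn (hT : T.IsAcyclic) {A S : Finset V} :
    S ∈ subtreesIn T A ↔ S.Nonempty ∧ InnerConnected T S ∧ S ⊆ A := by
  simp only [subtreesIn, Finset.mem_filter, mem_subtrees hT, and_assoc]

theorem mem_subtreesAt (hT : T.IsAcyclic) {A S : Finset V} {v : V} :
    S ∈ subtreesAt T A v ↔ InnerConnected T S ∧ S ⊆ A ∧ v ∈ S := by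
  simp only [subtreesAt, Finset.mem_filter, mem_subtreesIn hT]
  exact ⟨fun h => ⟨h.1.2.1, h.1.2.2, h.2⟩, fun h => ⟨⟨⟨v, h.2.2⟩, h.1, h.2.1⟩, h.2.2⟩⟩

namespace OnlyEdge

variable [DecidableEq V] {A B : Finset V} {v u : V}

theorem injOn_union (hT : T.IsAcyclic) (h : OnlyEdge T A B v u) :
    Set.InjOn (fun p : Finset V × Finset V => p.1 ∪ p.2)
      (subtreesAt T A v ×ˢ subtreesAt T B u : Finset _) := by
  rintro ⟨S₁, S₂⟩ hp ⟨S₁', S₂'⟩ hp' heq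
  simp only [Finset.coe_product, Set.mem_prod, Finset.mem_coe, mem_subtreesAt hT] at hp hp' heq
  have e1 := h.union_inter_left hp.1.2.1 hp.2.2.1
  have e2 := h.union_inter_right hp.1.2.1 hp.2.2.1
  rw [heq, h.union_inter_left hp'.1.2.1 hp'.2.2.1] at e1
  rw [heq, h.union_inter_right hp'.1.2.1 hp'.2.2.1] at e2
  rw [e1, e2]

theorem mem_image_union (hT : T.IsAcyclic) (h : OnlyEdge T A B v u) {S : Finset V} :
    S ∈ (subtreesAt T A v ×ˢ subtreesAt T B u).image (fun p => p.1 ∪ p.2) ↔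
      InnerConnected T S ∧ S ⊆ A ∪ B ∧ v ∈ S ∧ u ∈ S := by
  simp only [Finset.mem_image, Finset.mem_product, mem_subtreesAt hT, Prod.exists]
  constructor
  · rintro ⟨S₁, S₂, ⟨h₁, h₂⟩, rfl⟩
    exact ⟨h.innerConnected_union h₁.1 h₂.1 h₁.2.2 h₂.2.2, Finset.union_subset_union h₁.2.1 h₂.2.1,
      Finset.mem_union_left _ h₁.2.2, Finset.mem_union_right _ h₂.2.2⟩
  · rintro ⟨hc, hS, hv, hu⟩
    refine ⟨S ∩ A, S ∩ B, ⟨⟨h.innerConnected_inter hS hc hv, Finset.inter_subset_right,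
      Finset.mem_inter.2 ⟨hv, h.left_mem⟩⟩, h.symm.innerConnected_inter
        (by rwa [Finset.union_comm]) hc hu, Finset.inter_subset_right,
      Finset.mem_inter.2 ⟨hu, h.right_mem⟩⟩, ?_⟩
    rw [← Finset.inter_union_distrib_left, Finset.inter_eq_left.2 hS]

/-- A subtree through `v` lies in `A` or is uniquely a union of one through `v` and one through `u`.
A general weight `f` serves both counts and total orders. -/
theorem sum_subtreesAt (hT : T.IsAcyclic) (h : OnlyEdge T A B v u) (f : Finset V → ℝ) :
    ∑ S ∈ subtreesAt T (A ∪ B) v, f S = ∑ S ∈ subtreesAt T A v, f S +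
      ∑ p ∈ subtreesAt T A v ×ˢ subtreesAt T B u, f (p.1 ∪ p.2) := by
  have e : subtreesAt T (A ∪ B) v = subtreesAt T A v ∪
      (subtreesAt T A v ×ˢ subtreesAt T B u).image (fun p => p.1 ∪ p.2) := by
    ext S
    rw [Finset.mem_union, h.mem_image_union hT, mem_subtreesAt hT, mem_subtreesAt hT]
    constructor
    · rintro ⟨hc, hS, hv⟩
      rcases h.subset_left_or_right hS hc with hA | hB | hu
      · exact .inl ⟨hc, hA, hv⟩
      · exact absurd (hB hv) (h.not_mem_right h.left_mem)
      · exact .inr ⟨hc, hS, hu⟩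
    · rintro (h' | h')
      · exact ⟨h'.1, h'.2.1.trans Finset.subset_union_left, h'.2.2⟩
      · exact ⟨h'.1, h'.2.1, h'.2.2.1⟩
  rw [e, Finset.sum_union, Finset.sum_image (h.injOn_union hT)]
  rw [Finset.disjoint_left]
  intro S h₁ h₂
  rw [h.mem_image_union hT] at h₂
  rw [mem_subtreesAt hT] at h₁
  exact h.symm.not_mem_right h.right_mem (h₁.2.1 h₂.2.2.2)

theorem sum_subtreesIn (hT : T.IsAcyclic) (h : OnlyEdge T A B v u) (f : Finset V → ℝ) :
    ∑ S ∈ subtreesIn T (A ∪ B), f S =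
      ∑ S ∈ subtreesIn T A, f S + ∑ S ∈ subtreesIn T B, f S +
        ∑ p ∈ subtreesAt T A v ×ˢ subtreesAt T B u, f (p.1 ∪ p.2) := by
  have e : subtreesIn T (A ∪ B) = (subtreesIn T A ∪ subtreesIn T B) ∪
      (subtreesAt T A v ×ˢ subtreesAt T B u).image (fun p => p.1 ∪ p.2) := by
    ext S
    rw [Finset.mem_union, Finset.mem_union, h.mem_image_union hT, mem_subtreesIn hT,
      mem_subtreesIn hT, mem_subtreesIn hT]
    constructor
    · rintro ⟨hn, hc, hS⟩
      rcases h.subset_left_or_right hS hc with hA | hB | hu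
      · exact .inl (.inl ⟨hn, hc, hA⟩)
      · exact .inl (.inr ⟨hn, hc, hB⟩)
      · exact .inr ⟨hc, hS, hu⟩
    · rintro ((h' | h') | h')
      · exact ⟨h'.1, h'.2.1, h'.2.2.trans Finset.subset_union_left⟩
      · exact ⟨h'.1, h'.2.1, h'.2.2.trans Finset.subset_union_right⟩
      · exact ⟨⟨v, h'.2.2.1⟩, h'.1, h'.2.1⟩
  rw [e, Finset.sum_union, Finset.sum_image (h.injOn_union hT), Finset.sum_union]
  · rw [Finset.disjoint_left]
    intro S h₁ h₂
    rw [mem_subtreesIn hT] at h₁ h₂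
    obtain ⟨x, hx⟩ := h₁.1
    exact h.not_mem_right (h₁.2.2 hx) (h₂.2.2 hx)
  · rw [Finset.disjoint_left]
    intro S h₁ h₂
    rw [h.mem_image_union hT] at h₂
    rw [Finset.mem_union, mem_subtreesIn hT, mem_subtreesIn hT] at h₁
    rcases h₁ with h₁ | h₁
    · exact h.symm.not_mem_right h.right_mem (h₁.2.2 h₂.2.2.2)
    · exact h.not_mem_right h.left_mem (h₁.2.2 h₂.2.2.1)

theorem sum_card_product (hT : T.IsAcyclic) (h : OnlyEdge T A B v u) :
    ∑ p ∈ subtreesAt T A v ×ˢ subtreesAt T B u, ((p.1 ∪ p.2).card : ℝ) =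
      (∑ S ∈ subtreesAt T A v, (S.card : ℝ)) * (∑ _S ∈ subtreesAt T B u, 1) +
        (∑ _S ∈ subtreesAt T A v, 1) * ∑ S ∈ subtreesAt T B u, (S.card : ℝ) := by
  rw [Finset.sum_mul_sum, Finset.sum_mul_sum, ← Finset.sum_product', ← Finset.sum_product',
    ← Finset.sum_add_distrib]
  refine Finset.sum_congr rfl fun p hp => ?_
  rw [Finset.mem_product, mem_subtreesAt hT, mem_subtreesAt hT] at hp
  rw [Finset.card_union_of_disjoint (h.disjoint.mono hp.1.2.1 hp.2.2.1)]
  push_cast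
  ring

end OnlyEdge

end InnerConnected

/-! ### Paths and the diameter of a tree graph. -/

section Diam

variable {V : Type*} {T : SimpleGraph V}

theorem length_le_diam [Fintype V] (hT : T.IsTree) {x y : V} (p : T.Walk x y) (hp : p.IsPath) :
    p.length ≤ T.diam := by
  obtain ⟨q, hq, hql⟩ := hT.connected.exists_path_of_dist x y
  have := hT.nonempty
  rw [(hT.existsUnique_path x y).unique hp hq, hql]
  exact SimpleGraph.dist_le_diam (SimpleGraph.connected_iff_ediam_ne_top.1 hT.connected)

theorem diam_lt_card [Fintype V] (hT : T.IsTree) : T.diam < Fintype.card V := by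
  have := hT.nonempty
  obtain ⟨x, y, hxy⟩ := T.exists_dist_eq_diam
  obtain ⟨q, hq, hql⟩ := hT.connected.exists_path_of_dist x y
  rw [← hxy, ← hql]
  exact hq.length_lt

end Diam

/-! ### Plane trees describing a tree graph. -/

section Realizes

variable {V : Type*} [DecidableEq V] {T : SimpleGraph V}

/-- The plane tree `t` describes the part of `T` on the vertex set `A`, rooted at `v`. -/
inductive Realizes (T : SimpleGraph V) : PlaneTree → Finset V → V → Prop
  | single (v : V) : Realizes T .single {v} v
  | join {a b : PlaneTree} {A B : Finset V} {v u : V} : Realizes T a A v → Realizes T b B u →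
      Disjoint A B → T.Adj v u → Realizes T (.join a b) (A ∪ B) v

namespace Realizes

variable {t : PlaneTree} {A : Finset V} {v : V}

theorem root_mem (h : Realizes T t A v) : v ∈ A := by
  induction h with
  | single v => exact Finset.mem_singleton_self v
  | join _ _ _ _ ha _ => exact Finset.mem_union_left _ ha

theorem exists_insert (h : Realizes T t A v) {x y : V} (hx : x ∈ A) (hy : y ∉ A)
    (hxy : T.Adj x y) : ∃ t', Realizes T t' (insert y A) v := by
  induction h with
  | single v =>
    obtain rfl := Finset.mem_singleton.1 hx
    refine ⟨.join .single .single, ?_⟩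
    rw [Finset.insert_eq, Finset.union_comm]
    exact join (single x) (single y) (by simpa using hxy.ne) hxy
  | @join a b A B v u ha hb hAB hvu iha ihb =>
    rw [Finset.mem_union, not_or] at hy
    rcases Finset.mem_union.1 hx with hx | hx
    · obtain ⟨t', ht'⟩ := iha hx hy.1
      rw [← Finset.insert_union]
      exact ⟨_, ht'.join hb (Finset.disjoint_insert_left.2 ⟨hy.2, hAB⟩) hvu⟩
    · obtain ⟨t', ht'⟩ := ihb hx hy.2
      rw [← Finset.union_insert]
      exact ⟨_, ha.join ht' (Finset.disjoint_insert_right.2 ⟨hy.1, hAB⟩) hvu⟩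

theorem order_eq (h : Realizes T t A v) : t.order = A.card := by
  induction h with
  | single v => rfl
  | join _ _ hAB _ iha ihb =>
    rw [Finset.card_union_of_disjoint hAB, PlaneTree.order, iha, ihb]

theorem exists_path_height (h : Realizes T t A v) :
    ∃ x, ∃ p : T.Walk v x, p.IsPath ∧ (∀ w ∈ p.support, w ∈ A) ∧ p.length = t.height := by
  induction h with
  | single v => exact ⟨v, .nil, by simp, by simp, rfl⟩
  | @join a b A B v u ha hb hAB hvu iha ihb =>
    obtain ⟨x, p, hp, hpA, hpl⟩ := iha
    obtain ⟨y, q, hq, hqB, hql⟩ := ihb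
    rcases le_total a.height (b.height + 1) with hle | hle
    · refine ⟨y, q.cons hvu, hq.cons fun hv => Finset.disjoint_left.1 hAB ha.root_mem (hqB v hv),
        ?_, ?_⟩
      · intro w hw
        rw [SimpleGraph.Walk.support_cons, List.mem_cons] at hw
        rcases hw with rfl | hw
        · exact Finset.mem_union_left _ ha.root_mem
        · exact Finset.mem_union_right _ (hqB w hw)
      · rw [SimpleGraph.Walk.length_cons, hql, PlaneTree.height, max_eq_right hle]
    · exact ⟨x, p, hp, fun w hw => Finset.mem_union_left _ (hpA w hw),
        by rw [hpl, PlaneTree.height, max_eq_left hle]⟩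

theorem exists_path_diam (h : Realizes T t A v) :
    ∃ x y, ∃ p : T.Walk x y, p.IsPath ∧ p.length = t.diam := by
  induction h with
  | single v => exact ⟨v, v, .nil, by simp, rfl⟩
  | @join a b A B v u ha hb hAB hvu iha ihb =>
    rw [PlaneTree.diam]
    rcases max_choice (max a.diam b.diam) (a.height + b.height + 1) with e | e
    · rw [e]
      rcases max_choice a.diam b.diam with e | e <;> rw [e]
      exacts [iha, ihb]
    · rw [e]
      obtain ⟨x, p, hp, hpA, hpl⟩ := ha.exists_path_height
      obtain ⟨y, q, hq, hqB, hql⟩ := hb.exists_path_height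
      refine ⟨x, y, p.reverse.append (q.cons hvu), ?_, ?_⟩
      · rw [SimpleGraph.Walk.isPath_def, SimpleGraph.Walk.support_append,
          SimpleGraph.Walk.support_cons, List.tail_cons, List.nodup_append]
        refine ⟨hp.reverse.support_nodup, hq.support_nodup, fun w hw z hz => ?_⟩
        rw [SimpleGraph.Walk.support_reverse, List.mem_reverse] at hw
        rintro rfl
        exact Finset.disjoint_left.1 hAB (hpA w hw) (hqB w hz)
      · rw [SimpleGraph.Walk.length_append, SimpleGraph.Walk.length_reverse,
          SimpleGraph.Walk.length_cons, hpl, hql, add_assoc]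

theorem innerConnected (h : Realizes T t A v) : InnerConnected T A := by
  induction h with
  | single v =>
    refine innerConnected_of_root v fun x hx => ?_
    obtain rfl := Finset.mem_singleton.1 hx
    exact .refl
  | @join a b A B v u ha hb hAB hvu iha ihb =>
    refine innerConnected_of_root v fun x hx => ?_
    rcases Finset.mem_union.1 hx with hx | hx
    · exact (iha v ha.root_mem x hx).mono Finset.subset_union_left
    · exact Relation.ReflTransGen.head ⟨hvu, Finset.mem_union_left _ ha.root_mem,
        Finset.mem_union_right _ hb.root_mem⟩
        ((ihb u hb.root_mem x hx).mono Finset.subset_union_right)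

variable [Fintype V]

theorem subtreesAt_singleton (hT : T.IsAcyclic) (v : V) : subtreesAt T {v} v = {{v}} := by
  ext S
  rw [mem_subtreesAt hT, Finset.mem_singleton]
  constructor
  · rintro ⟨-, hS, hv⟩
    exact hS.antisymm (Finset.singleton_subset_iff.2 hv)
  · rintro rfl
    exact ⟨(single v).innerConnected, subset_rfl, Finset.mem_singleton_self v⟩

theorem subtreesIn_singleton (hT : T.IsAcyclic) (v : V) : subtreesIn T {v} = {{v}} := by
  ext S
  rw [mem_subtreesIn hT, Finset.mem_singleton]
  constructor
  · rintro ⟨hn, -, hS⟩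
    exact hn.subset_singleton_iff.1 hS
  · rintro rfl
    exact ⟨Finset.singleton_nonempty v, (single v).innerConnected, subset_rfl⟩

theorem sums_subtreesAt (hT : T.IsAcyclic) (h : Realizes T t A v) :
    ∑ _S ∈ subtreesAt T A v, (1 : ℝ) = t.rootedCount ∧
      ∑ S ∈ subtreesAt T A v, (S.card : ℝ) = t.rootedTotal := by
  induction h with
  | single v => simp [subtreesAt_singleton hT, PlaneTree.rootedCount, PlaneTree.rootedTotal]
  | @join a b A B v u ha hb hAB hvu iha ihb =>
    have hE := OnlyEdge.of_isAcyclic hT hAB ha.root_mem hb.root_mem ha.innerConnected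
      hb.innerConnected hvu
    rw [hE.sum_subtreesAt hT, hE.sum_subtreesAt hT, hE.sum_card_product hT, iha.1, iha.2, ihb.1,
      ihb.2, Finset.sum_product]
    simp only [Finset.sum_const (s := subtreesAt T A v), nsmul_eq_mul, ihb.1]
    have := iha.1
    rw [Finset.sum_const, nsmul_eq_mul, mul_one] at this
    rw [this]
    exact ⟨by rw [PlaneTree.rootedCount]; ring, rfl⟩

theorem sums_subtreesIn (hT : T.IsAcyclic) (h : Realizes T t A v) :
    ∑ _S ∈ subtreesIn T A, (1 : ℝ) = t.count ∧
      ∑ S ∈ subtreesIn T A, (S.card : ℝ) = t.total := by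
  induction h with
  | single v => simp [subtreesIn_singleton hT, PlaneTree.count, PlaneTree.total]
  | @join a b A B v u ha hb hAB hvu iha ihb =>
    have hE := OnlyEdge.of_isAcyclic hT hAB ha.root_mem hb.root_mem ha.innerConnected
      hb.innerConnected hvu
    have h1 := ha.sums_subtreesAt hT
    have h2 := hb.sums_subtreesAt hT
    rw [hE.sum_subtreesIn hT, hE.sum_subtreesIn hT, hE.sum_card_product hT, iha.1, iha.2, ihb.1,
      ihb.2, h1.1, h1.2, h2.1, h2.2, Finset.sum_product]
    simp only [Finset.sum_const (s := subtreesAt T A v), nsmul_eq_mul, h2.1]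
    have := h1.1
    rw [Finset.sum_const, nsmul_eq_mul, mul_one] at this
    rw [this]
    exact ⟨rfl, rfl⟩

/-- A maximal described vertex set is everything, since otherwise a boundary edge would extend it by
`exists_insert`. -/
theorem exists_univ (hT : T.Connected) : ∃ t v, Realizes T t Finset.univ v := by
  obtain ⟨v⟩ := hT.nonempty
  have hfin : {A : Finset V | ∃ t, Realizes T t A v}.Finite := Set.toFinite _
  obtain ⟨A, ⟨t, ht⟩, hmax⟩ := hfin.exists_maximal ⟨{v}, _, single v⟩
  suffices A = Finset.univ from ⟨t, v, this ▸ ht⟩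
  by_contra hne
  obtain ⟨w, hw⟩ : ∃ w, w ∉ A := by
    by_contra! hall
    exact hne (Finset.eq_univ_iff_forall.2 hall)
  obtain ⟨p⟩ := hT.preconnected v w
  obtain ⟨d, -, hd1, hd2⟩ := p.exists_boundary_dart (A : Set V) ht.root_mem hw
  obtain ⟨t', ht'⟩ := ht.exists_insert hd1 hd2 d.adj
  exact hd2 (hmax ⟨t', ht'⟩ (Finset.subset_insert _ _) (Finset.mem_insert_self _ _))

end Realizes

/-- One inequality between the diameters suffices: a smaller diameter only strengthens the bound. -/
theorem meanSubtreeOrder_eq [Fintype V] (hT : T.IsTree) : ∃ t : PlaneTree,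
    t.order = Fintype.card V ∧ t.diam ≤ T.diam ∧ meanSubtreeOrder T = t.total / t.count := by
  obtain ⟨t, v, ht⟩ := Realizes.exists_univ hT.connected
  obtain ⟨x, y, p, hp, hpl⟩ := ht.exists_path_diam
  refine ⟨t, ht.order_eq, hpl ▸ length_le_diam hT p hp, ?_⟩
  have e : subtreesIn T Finset.univ = subtrees T := by
    ext S
    rw [mem_subtreesIn hT.isAcyclic, mem_subtrees hT.isAcyclic]
    simp
  have h := ht.sums_subtreesIn hT.isAcyclic
  rw [e] at h
  rw [meanSubtreeOrder, h.2, ← h.1]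
  simp

end Realizes

theorem mainTheorem6 :
    ∃ C : ℝ, ∀ (V : Type u) [Fintype V] (T : SimpleGraph V), T.IsTree →
      meanSubtreeOrder T ≤
        (Fintype.card V : ℝ) - Real.logb 2 (Fintype.card V : ℝ)
          - 2 * Real.logb 2 ((Fintype.card V : ℝ) - (T.diam : ℝ)) + C := by
  refine ⟨54, fun V _ T hT => ?_⟩
  classical
  obtain ⟨t, hn, hd, hm⟩ := meanSubtreeOrder_eq hT
  have h1 := t.mean_le
  have h2 : (T.diam : ℝ) < Fintype.card V := by exact_mod_cast diam_lt_card hT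
  have h3 : (t.diam : ℝ) ≤ T.diam := by exact_mod_cast hd
  rw [hn] at h1
  have h4 := Real.logb_le_logb_of_le one_lt_two (sub_pos.2 h2) (sub_le_sub_left h3 _)
  rw [hm]
  linarith
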